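/- All spaces are completely regular Hausdorff, $\beta X$ is the Stone–Čech compactification of $X$, cardinals are regarded as initial ordinals, an ordinal carries its order topology, $\alpha_d$ denotes the set $\alpha$ with the discrete topology, and $\sqcup$ is the disjoint union of spaces. A cardinal $\kappa$ is *measurable* if it is uncountable and there is a $\kappa$-complete nonprincipal ultrafilter on $\kappa$ (closed under intersections of fewer than $\kappa$ members). A space $X$ is *$\kappa$-Lindelöf* if every open cover of $X$ has a subcover of cardinality $<\kappa$. Put $$\upsilon_\kappa X=\bigcap\{\,Y : X\subset Y\subset\beta X,\ Y \text{ is } \kappa\text{-Lindelöf}\,\}\subset\beta X .$$ The *Lindelöf degree* $L(X)$ is the smallest infinite cardinal $\kappa$ such that every open cover of $X$ has a subcover of cardinality $\le\kappa$, and the *outer Lindelöf degree* is $oL(X)=\min\{\kappa : X=\upsilon_{\kappa^+}X\}+\aleph_0$. A space $X$ is *functorially $\kappa$-Lindelöfifiable* if there are a $\kappa$-Lindelöf space $N$ and a continuous map $i:X\to N$ such that every continuous map $f$ from $X$ to a $\kappa$-Lindelöf space $Y$ can be written as $f=\tilde f\circ i$ for a unique continuous map $\tilde f:N\to Y$. Let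 $\kappa$ and $\lambda$ be infinite non-measurable cardinals. 1. If $\aleph_0<\operatorname{cf}(\kappa)=\kappa<\lambda$ and no cardinal less than or equal to $\lambda$ is measurable, then $$oL(\kappa\sqcup\lambda_d)=\kappa<L(\kappa\sqcup\lambda_d)=\lambda .$$ 2. If $\kappa<\operatorname{cf}(\lambda)=\lambda$, then $$oL(\kappa_d\sqcup\lambda)=L(\kappa_d\sqcup\lambda)=\lambda ,$$ the space $\kappa_d\sqcup\lambda$ is functorially $\mu$-Lindelöfifiable for every cardinal $\mu$ with $\kappa<\mu\le\lambda$, and, if $\kappa>\aleph_0$, it is not functorially $\kappa$-Lindelöfifiable. -/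

import Mathlib

open Set Cardinal

universe u

/-- A cardinal `κ` is measurable if it is uncountable and there is a `κ`-complete nonprincipal
ultrafilter on (a set of cardinality) `κ`. -/
def IsMeasurableCardinal (κ : Cardinal.{u}) : Prop :=
  ℵ₀ < κ ∧ ∃ U : Ultrafilter κ.ord.ToType,
    CardinalInterFilter (U : Filter κ.ord.ToType) κ ∧ ∀ x : κ.ord.ToType, U ≠ pure x

/-- The ordinal `α` as a topological space, with its order topology. -/
def OrdSpace (α : Ordinal.{u}) : Type u := α.ToType

noncomputable instance (α : Ordinal.{u}) : LinearOrder (OrdSpace α) :=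
  inferInstanceAs (LinearOrder α.ToType)

noncomputable instance (α : Ordinal.{u}) : TopologicalSpace (OrdSpace α) := Preorder.topology (OrdSpace α)

instance (α : Ordinal.{u}) : OrderTopology (OrdSpace α) := ⟨rfl⟩

/-- The ordinal `α` as a discrete topological space. -/
def OrdDiscrete (α : Ordinal.{u}) : Type u := α.ToType

instance (α : Ordinal.{u}) : TopologicalSpace (OrdDiscrete α) := ⊥

instance (α : Ordinal.{u}) : DiscreteTopology (OrdDiscrete α) := ⟨rfl⟩

/-- `X` is `κ`-Lindelöf: every open cover has a subcover of cardinality `< κ`. -/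
def IsKLindelof (κ : Cardinal.{u}) (X : Type u) [TopologicalSpace X] : Prop :=
  ∀ U : Set (Set X), (∀ u ∈ U, IsOpen u) → ⋃₀ U = Set.univ →
    ∃ V : Set (Set X), V ⊆ U ∧ ⋃₀ V = Set.univ ∧ #V < κ

/-- Let `P` be a property of spaces, viewed as a full subcategory of the category of completely
regular Hausdorff spaces. `X` is functorially `P`-ifiable if there is a continuous map
`i : X → N` to an object `N` of `P` through which every continuous map from `X` to an object of
`P` factors uniquely. -/
def FunctoriallyIfiable (P : (Y : Type u) → [TopologicalSpace Y] → Prop)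
    (X : Type u) [TopologicalSpace X] : Prop :=
  ∃ (N : Type u) (_ : TopologicalSpace N), T35Space N ∧ P N ∧
    ∃ i : C(X, N), ∀ (Y : Type u) [TopologicalSpace Y], T35Space Y → P Y →
      ∀ f : C(X, Y), ∃! g : C(N, Y), g.comp i = f

/-- `X` admits a functorial `κ`-Lindelöfification. -/
def FunctoriallyKLindelofifiable (κ : Cardinal.{u}) (X : Type u) [TopologicalSpace X] : Prop :=
  FunctoriallyIfiable (fun Y [TopologicalSpace Y] => IsKLindelof κ Y) X

/-- The intersection, inside the Stone-Čech compactification of `X`, of all `κ`-Lindelöf subspaces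
that contain `X`. -/
def upsilon (κ : Cardinal.{u}) (X : Type u) [TopologicalSpace X] : Set (StoneCech X) :=
  ⋂₀ {Y : Set (StoneCech X) | range (stoneCechUnit : X → StoneCech X) ⊆ Y ∧ IsKLindelof κ Y}

/-- The Lindelöf degree `L(X)`: the smallest infinite cardinal `κ` such that every open cover
has a subcover of cardinality `≤ κ`. -/
noncomputable def lindelofDegree (X : Type u) [TopologicalSpace X] : Cardinal.{u} :=
  sInf {κ : Cardinal.{u} | ℵ₀ ≤ κ ∧
    ∀ U : Set (Set X), (∀ u ∈ U, IsOpen u) → ⋃₀ U = Set.univ →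
      ∃ V : Set (Set X), V ⊆ U ∧ ⋃₀ V = Set.univ ∧ #V ≤ κ}

/-- The outer Lindelöf degree `oL(X)`: the least cardinal `κ` with `X = υ_{κ⁺} X` (as subsets of
the Stone-Čech compactification), plus `ℵ₀`. -/
noncomputable def outerLindelofDegree (X : Type u) [TopologicalSpace X] : Cardinal.{u} :=
  sInf {κ : Cardinal.{u} |
    range (stoneCechUnit : X → StoneCech X) = upsilon (Order.succ κ) X} + ℵ₀

/-- Every open cover of `X` has a subcover of cardinality at most `|X|`. -/
theorem exists_subcover_card_le (X : Type u) [TopologicalSpace X] (U : Set (Set X))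
    (hU : ⋃₀ U = Set.univ) : ∃ V : Set (Set X), V ⊆ U ∧ ⋃₀ V = Set.univ ∧ #V ≤ #X := by
  have h : ∀ x : X, ∃ u ∈ U, x ∈ u := fun x => by
    have hx : x ∈ ⋃₀ U := hU ▸ mem_univ x
    exact hx
  choose f hf hx using h
  refine ⟨range f, ?_, ?_, mk_range_le⟩
  · rintro _ ⟨x, rfl⟩
    exact hf x
  · exact eq_univ_of_forall fun x => ⟨f x, ⟨x, rfl⟩, hx x⟩

/-- The minimum in the definition of `lindelofDegree` is over a nonempty set. -/
theorem lindelofDegree_set_nonempty (X : Type u) [TopologicalSpace X] :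
    {κ : Cardinal.{u} | ℵ₀ ≤ κ ∧
      ∀ U : Set (Set X), (∀ u ∈ U, IsOpen u) → ⋃₀ U = Set.univ →
        ∃ V : Set (Set X), V ⊆ U ∧ ⋃₀ V = Set.univ ∧ #V ≤ κ}.Nonempty := by
  refine ⟨max #X ℵ₀, le_max_right _ _, fun U _ hU => ?_⟩
  obtain ⟨V, h1, h2, h3⟩ := exists_subcover_card_le X U hU
  exact ⟨V, h1, h2, h3.trans (le_max_left _ _)⟩

/-- The minimum in the definition of `outerLindelofDegree` is over a nonempty set. -/
theorem outerLindelofDegree_set_nonempty (X : Type u) [TopologicalSpace X] :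
    {κ : Cardinal.{u} |
      range (stoneCechUnit : X → StoneCech X) = upsilon (Order.succ κ) X}.Nonempty := by
  refine ⟨#X, Subset.antisymm (subset_sInter fun Y hY => hY.1) (sInter_subset_of_mem ?_)⟩
  refine ⟨le_rfl, ?_⟩
  intro U _ hU
  obtain ⟨V, h1, h2, h3⟩ := exists_subcover_card_le _ U hU
  exact ⟨V, h1, h2, Order.lt_succ_iff.2 (h3.trans mk_range_le)⟩

/-! A continuous map from a well-order of uncountable cofinality to a compact Hausdorff space
converges at the end, since two cluster points would give disjoint clubs. If `c` is at most the
cofinality, the limit lies in every `c`-Lindelöf subspace containing the image: fewer than `c` sets,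
each missing a tail, cannot cover it. Hence a closed copy of a regular uncountable `c` in `X` yields
a point of `υ_c X` outside `X`, so `c ≤ oL(X)`. This gives the lower bounds for `oL`.

The bound `oL ≤ κ` in the first claim uses non-measurability: a point of the remainder in the
closure of the discrete summand comes from an ultrafilter that is not countably complete, so
countably many closures of clopen pieces cover that summand and miss the point. Adding `κ`
singletons gives a `κ⁺`-Lindelöf subspace without it. The other upper bounds count points.

In the second claim, adjoining the end of `λ` gives the `μ`-Lindelöfification. For `μ = κ`, a
universal `N` would map into the principal ultrafilters on `κ_d`, hence split into `κ` nonempty open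
pieces. -/

open Filter Topology

/-! ### Limits at the end of a well-order -/

section WellOrder

variable {Z K : Type u} [LinearOrder Z] [TopologicalSpace K] {f : Z → K}

/-- A closed cofinal subset of a linear order is a club. -/
theorem IsClosed.isClub [TopologicalSpace Z] [OrderTopology Z] {s : Set Z} (hs : IsClosed s)
    (hc : IsCofinal s) : IsClub s :=
  ⟨fun _ hd hne _ _ ha => closure_minimal hd hs (ha.mem_closure hne), hc⟩

/-- A continuous map from a well-order of uncountable cofinality to a compact Hausdorff space
converges at the end. -/
theorem exists_tendsto_atTop_of_aleph0_lt_cof [WellFoundedLT Z] [TopologicalSpace Z]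
    [OrderTopology Z] [Nonempty Z] [T2Space K] [CompactSpace K]
    (hZ : ℵ₀ < Order.cof Z) (hf : Continuous f) : ∃ p, Tendsto f atTop (𝓝 p) := by
  obtain ⟨p, hp⟩ := exists_clusterPt_of_compactSpace (map f atTop)
  refine ⟨p, le_nhds_of_unique_clusterPt fun q hq => ?_⟩
  by_contra hne
  obtain ⟨u, hqu, hu, v, hpv, hv, hd⟩ := exists_open_nhds_disjoint_closure hne
  have key : ∀ {x : K} {w : Set K}, MapClusterPt x atTop f → x ∈ w → IsOpen w →
      IsClub (f ⁻¹' closure w) := fun hx hxw hw =>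
    (isClosed_closure.preimage hf).isClub fun a => by
      obtain ⟨b, hab, hb⟩ :=
        frequently_atTop.1 (mapClusterPt_iff_frequently.1 hx _ (hw.mem_nhds hxw)) a
      exact ⟨b, subset_closure hb, hab⟩
  obtain ⟨z, h1, h2⟩ := ((key hq hqu hu).inter hZ.ne' (key hp hpv hv)).nonempty
  exact hd.le_bot ⟨h1, h2⟩

/-- A `c`-Lindelöf subspace containing the range of a map on an order of cofinality at least `c`
contains the limit of the map at the end. -/
theorem IsKLindelof.mem_of_tendsto_atTop [Nonempty Z] [T2Space K] {c : Cardinal.{u}} (hc : c ≤ Order.cof Z)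
    {Y : Set K} (hY : IsKLindelof c Y) (hfY : range f ⊆ Y) {p : K} (hp : Tendsto f atTop (𝓝 p)) :
    p ∈ Y := by
  by_contra hpY
  -- Every point other than `p` has a neighbourhood missing a tail of `f`; these neighbourhoods form
  -- the cover.
  obtain ⟨V, hVU, hV, hcard⟩ := hY {s | IsOpen s ∧ ∃ z, ∀ w ≥ z, (⟨f w, hfY ⟨w, rfl⟩⟩ : Y) ∉ s}
    (fun _ h => h.1) (eq_univ_of_forall fun y => by
      obtain ⟨u, v, hu, hv, hyu, hpv, hd⟩ := t2_separation (fun h => hpY (h ▸ y.2) : y.1 ≠ p)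
      obtain ⟨z, hz⟩ := eventually_atTop.1 (hp.eventually (hv.mem_nhds hpv))
      exact ⟨Subtype.val ⁻¹' u, ⟨hu.preimage continuous_subtype_val, z,
        fun w hw h => hd.le_bot ⟨h, hz w hw⟩⟩, hyu⟩)
  choose z hz using fun v : V => (hVU v.2).2
  have hnc : ¬ IsCofinal (range z) := fun h =>
    ((Order.cof_le h).trans mk_range_le).not_gt (hcard.trans_le hc)
  obtain ⟨x, hx⟩ := not_isCofinal_iff.1 hnc
  obtain ⟨v, hv, hxv⟩ : (⟨f x, hfY ⟨x, rfl⟩⟩ : Y) ∈ ⋃₀ V := hV ▸ mem_univ _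
  exact hz ⟨v, hv⟩ x (hx _ ⟨_, rfl⟩).le hxv

/-- A convergent continuous image of a well-order together with its limit is compact. -/
theorem isCompact_insert_range_of_tendsto_atTop [WellFoundedLT Z] [TopologicalSpace Z]
    [OrderTopology Z] [Nonempty Z] (hf : Continuous f) {p : K}
    (hp : Tendsto f atTop (𝓝 p)) : IsCompact (insert p (range f)) := by
  -- Suprema and a bottom make initial segments compact, so `atTop` is coarser than `cocompact`.
  let := WellFoundedLT.toOrderBot (α := Z)
  let := WellFoundedLT.conditionallyCompleteLinearOrderBot Z
  exact Tendsto.isCompact_insert_range_of_cocompact (hp.mono_left cocompact_le_atTop) hf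

end WellOrder

/-! ### Permanence of the `c`-Lindelöf property -/

section Lindelof

theorem IsKLindelof.mono {c d : Cardinal.{u}} (h : c ≤ d) {X : Type u} [TopologicalSpace X]
    (hX : IsKLindelof c X) : IsKLindelof d X := fun U hU hc => by
  obtain ⟨V, h1, h2, h3⟩ := hX U hU hc
  exact ⟨V, h1, h2, h3.trans_le h⟩

theorem IsKLindelof.of_surjective {c : Cardinal.{u}} {X Y : Type u} [TopologicalSpace X]
    [TopologicalSpace Y] (hX : IsKLindelof c X) {f : X → Y} (hf : Continuous f)
    (hs : Function.Surjective f) : IsKLindelof c Y := fun U hU hc => by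
  obtain ⟨V, h1, h2, h3⟩ := hX (preimage f '' U)
    (by rintro _ ⟨u, hu, rfl⟩; exact (hU u hu).preimage hf)
    (eq_univ_of_forall fun x => by
      obtain ⟨u, hu, hx⟩ : f x ∈ ⋃₀ U := hc ▸ mem_univ _
      exact ⟨_, ⟨u, hu, rfl⟩, hx⟩)
  choose g hgU hg using fun v : V => h1 v.2
  refine ⟨range g, by rintro _ ⟨v, rfl⟩; exact hgU v, eq_univ_of_forall fun y => ?_,
    mk_range_le.trans_lt h3⟩
  obtain ⟨x, rfl⟩ := hs y
  obtain ⟨v, hv, hx⟩ : x ∈ ⋃₀ V := h2 ▸ mem_univ _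
  refine ⟨_, ⟨⟨v, hv⟩, rfl⟩, ?_⟩
  have hx' : x ∈ f ⁻¹' g ⟨v, hv⟩ := by rwa [hg ⟨v, hv⟩]
  exact hx'

theorem IsCompact.elim_finite_subcover_sUnion {K : Type u} [TopologicalSpace K] {C : Set K}
    (hC : IsCompact C) {U : Set (Set K)} (hU : ∀ u ∈ U, IsOpen u) (hcov : C ⊆ ⋃₀ U) :
    ∃ V ⊆ U, V.Finite ∧ C ⊆ ⋃₀ V := by
  rw [sUnion_eq_biUnion] at hcov
  simpa only [sUnion_eq_biUnion] using hC.elim_finite_subcover_image hU hcov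

/-- A union of fewer than `c` compact sets is `c`-Lindelöf, for uncountable `c`. -/
theorem isKLindelof_iUnion_of_isCompact {c : Cardinal.{u}} (hc : ℵ₀ < c) {K ι : Type u}
    [TopologicalSpace K] (hι : #ι < c) {C : ι → Set K} (hC : ∀ i, IsCompact (C i)) :
    IsKLindelof c (⋃ i, C i : Set K) := fun U hU hcov => by
  have hC' : ∀ i, IsCompact (Subtype.val ⁻¹' C i : Set (⋃ i, C i : Set K)) := fun i => by
    rw [Subtype.isCompact_iff, Subtype.image_preimage_coe,
      inter_eq_right.2 (subset_iUnion C i)]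
    exact hC i
  choose t htU htf ht using fun i => (hC' i).elim_finite_subcover_sUnion hU (by simp [hcov])
  refine ⟨⋃ i, t i, iUnion_subset htU, eq_univ_of_forall fun y => ?_, ?_⟩
  · obtain ⟨i, hi⟩ := mem_iUnion.1 y.2
    obtain ⟨s, hs, hy⟩ := ht i hi
    exact ⟨s, mem_iUnion.2 ⟨i, hs⟩, hy⟩
  · refine (mk_iUnion_le t).trans_lt ?_
    refine lt_of_le_of_lt (mul_le_mul_right (ciSup_le' fun i => (htf i).lt_aleph0.le) _) ?_
    exact mul_lt_of_lt hc.le hι hc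

theorem isKLindelof_of_compactSpace {c : Cardinal.{u}} (hc : ℵ₀ < c) (K : Type u)
    [TopologicalSpace K] [CompactSpace K] : IsKLindelof c K := fun U hU hcov => by
  obtain ⟨t, h1, h2, h3⟩ := isCompact_univ.elim_finite_subcover_sUnion hU (by simp [hcov])
  exact ⟨t, h1, univ_subset_iff.1 h3, h2.lt_aleph0.trans hc⟩

end Lindelof

/-! ### Stone–Čech compactification and the two degrees -/

section StoneCech

variable {X : Type u} [TopologicalSpace X]

/-- An ultrafilter converging in the Stone-Čech compactification to a point in the closure of a
clopen set contains that set. -/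
theorem IsClopen.mem_of_tendsto_stoneCechUnit {A : Set X} (hA : IsClopen A) {p : StoneCech X}
    (hp : p ∈ closure (stoneCechUnit '' A)) {u : Ultrafilter X}
    (hu : Tendsto stoneCechUnit (u : Filter X) (𝓝 p)) : A ∈ u := by
  -- The indicator of a clopen set is continuous, so it extends to `StoneCech X`; the lift only
  -- adjusts the universe.
  let g : X → ULift.{u} Bool := fun x => ⟨A.boolIndicator x⟩
  have hg : Continuous g :=
    continuous_uliftUp.comp ((continuous_boolIndicator_iff_isClopen A).2 hA)
  have h1 : stoneCechExtend hg p = ⟨true⟩ := by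
    refine closure_minimal ?_ ((isClosed_singleton (x := (⟨true⟩ : ULift.{u} Bool))).preimage
      (continuous_stoneCechExtend hg)) hp
    rintro _ ⟨x, hx, rfl⟩
    simp [g, boolIndicator, hx]
  have h2 := ((continuous_stoneCechExtend hg).tendsto p).comp hu
  rw [stoneCechExtend_extends, h1, nhds_discrete, tendsto_pure] at h2
  filter_upwards [h2] with x hx
  by_contra hxA
  simp [g, boolIndicator, hxA] at hx

instance Sum.t35Space {A B : Type u} [TopologicalSpace A] [TopologicalSpace B] [T35Space A]
    [T35Space B] : T35Space (A ⊕ B) := by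
  have h : IsEmbedding (Sum.elim (Sum.inl ∘ stoneCechUnit) (Sum.inr ∘ stoneCechUnit) :
      A ⊕ B → StoneCech A ⊕ StoneCech B) :=
    IsEmbedding.sumElim_of_separatedNhds
      (IsEmbedding.inl.comp isEmbedding_stoneCechUnit)
      (IsEmbedding.inr.comp isEmbedding_stoneCechUnit)
      ⟨range Sum.inl, range Sum.inr, isOpen_range_inl, isOpen_range_inr,
        range_comp_subset_range _ _, range_comp_subset_range _ _,
        isCompl_range_inl_range_inr.disjoint⟩
  exact h.t35Space

theorem upsilon_anti {c d : Cardinal.{u}} (h : c ≤ d) : upsilon d X ⊆ upsilon c X :=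
  sInter_subset_sInter fun _ hY => ⟨hY.1, hY.2.mono h⟩

theorem range_subset_upsilon (c : Cardinal.{u}) :
    range (stoneCechUnit : X → StoneCech X) ⊆ upsilon c X :=
  subset_sInter fun _ hY => hY.1

theorem outerLindelofDegree_le {c : Cardinal.{u}} (hc : ℵ₀ ≤ c)
    (h : upsilon (Order.succ c) X ⊆ range (stoneCechUnit : X → StoneCech X)) :
    outerLindelofDegree X ≤ c :=
  (add_le_add_left (α := Cardinal.{u}) (csInf_le' ((range_subset_upsilon _).antisymm h)) _).trans
    (add_eq_left hc hc).le

theorem le_outerLindelofDegree {c : Cardinal.{u}}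
    (h : ¬ upsilon c X ⊆ range (stoneCechUnit : X → StoneCech X)) :
    c ≤ outerLindelofDegree X := by
  refine (le_csInf (outerLindelofDegree_set_nonempty X) fun d hd => ?_).trans (self_le_add_right _ _)
  by_contra! hdc
  exact h ((upsilon_anti (Order.succ_le_of_lt hdc)).trans (Eq.ge hd))

theorem lindelofDegree_le {c : Cardinal.{u}} (hc : ℵ₀ ≤ c) (hX : #X ≤ c) :
    lindelofDegree X ≤ c :=
  csInf_le' ⟨hc, fun U _ hU => by
    obtain ⟨V, h1, h2, h3⟩ := exists_subcover_card_le X U hU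
    exact ⟨V, h1, h2, h3.trans hX⟩⟩

variable (X) in
theorem aleph0_le_lindelofDegree : ℵ₀ ≤ lindelofDegree X :=
  (csInf_mem (lindelofDegree_set_nonempty X)).1

variable (X) in
theorem isKLindelof_succ_lindelofDegree : IsKLindelof (Order.succ (lindelofDegree X)) X :=
  fun U hU hc => by
    obtain ⟨V, h1, h2, h3⟩ := (csInf_mem (lindelofDegree_set_nonempty X)).2 U hU hc
    exact ⟨V, h1, h2, Order.lt_succ_iff.2 h3⟩

variable (X) in
theorem outerLindelofDegree_le_lindelofDegree : outerLindelofDegree X ≤ lindelofDegree X :=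
  outerLindelofDegree_le (aleph0_le_lindelofDegree X) <| sInter_subset_of_mem ⟨le_rfl,
    (isKLindelof_succ_lindelofDegree X).of_surjective
      (continuous_stoneCechUnit.subtype_mk fun x => ⟨x, rfl⟩) rangeFactorization_surjective⟩

end StoneCech

/-! ### Ultrafilter completeness and measurable cardinals -/

section Measurable

/-- If no cardinal up to `#α` is measurable, countably complete ultrafilters on `α` are
principal. -/
theorem exists_eq_pure_of_countableInterFilter {α : Type u}
    (hα : ∀ ν : Cardinal.{u}, ν ≤ #α → ¬ IsMeasurableCardinal ν) (U : Ultrafilter α)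
    [hU : CountableInterFilter (U : Filter α)] : ∃ x, U = pure x := by
  by_contra! hne
  -- The least number `ν` of null sets with non-null union would be measurable: minimality gives
  -- `ν`-completeness, and sending each point of the union to a null set containing it pushes `U` to
  -- a nonprincipal ultrafilter on `ν`.
  let P : Set Cardinal.{u} := {ν | ∃ S : Set (Set α), #S = ν ∧ (∀ s ∈ S, s ∉ U) ∧ ⋃₀ S ∈ U}
  have hsing : ∀ x, {x} ∉ U := fun x hx => hne x (Ultrafilter.eq_pure_of_finite_mem
    (finite_singleton x) hx |>.choose_spec.2.trans (by
      rw [(Ultrafilter.eq_pure_of_finite_mem (finite_singleton x) hx).choose_spec.1]))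
  have hP : #(range (singleton : α → Set α)) ∈ P :=
    ⟨_, rfl, by rintro _ ⟨x, rfl⟩; exact hsing x, by
      convert! univ_mem (f := (U : Filter α))
      exact eq_univ_of_forall fun x => ⟨_, ⟨x, rfl⟩, rfl⟩⟩
  let ν := sInf P
  obtain ⟨S, hSν, hS, hSU⟩ : ν ∈ P := csInf_mem ⟨_, hP⟩
  have hνα : ν ≤ #α := (csInf_le' hP).trans mk_range_le
  have hcomplete : CardinalInterFilter (U : Filter α) ν := ⟨fun T hT h => by
    by_contra hTU
    refine (csInf_le' (s := P) (a := #(compl '' T)) ⟨_, rfl, ?_, ?_⟩).not_gt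
      (mk_image_le.trans_lt hT)
    · rintro _ ⟨t, ht, rfl⟩
      exact Ultrafilter.compl_notMem_iff.2 (h t ht)
    · rw [← compl_sInter]
      exact Ultrafilter.compl_mem_iff_notMem.2 hTU⟩
  have hν : ℵ₀ < ν := by
    by_contra! h
    have hc : S.Countable := by rwa [← le_aleph0_iff_set_countable, hSν]
    have h2 : ⋂₀ (compl '' S) ∈ (U : Filter α) :=
      (countable_sInter_mem (hc.image _)).2 <| by
        rintro _ ⟨s, hs, rfl⟩
        exact Ultrafilter.compl_mem_iff_notMem.2 (hS s hs)
    rw [← compl_sUnion] at h2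
    exact Ultrafilter.compl_mem_iff_notMem.1 h2 hSU
  obtain ⟨e⟩ : Nonempty (S ≃ ν.ord.ToType) := Cardinal.eq.1 (by rw [mk_ord_toType, hSν])
  have hS0 : Nonempty S := by
    rw [← mk_ne_zero_iff, hSν]
    exact (aleph0_pos.trans hν).ne'
  classical
  let g : α → S := fun x => if h : x ∈ ⋃₀ S then ⟨h.choose, h.choose_spec.1⟩ else hS0.some
  refine hα ν hνα ⟨hν, U.map (e ∘ g), ?_, fun y hy => ?_⟩
  · rw [Ultrafilter.coe_map]
    infer_instance
  · have h1 : (e ∘ g) ⁻¹' {y} ∈ U := by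
      rw [← Ultrafilter.mem_map, hy]
      exact Ultrafilter.mem_pure.2 rfl
    refine hS _ (e.symm y).2 (mem_of_superset (inter_mem h1 hSU) ?_)
    rintro x ⟨hx, hxS⟩
    have hx' : g x = e.symm y := e.injective (by simpa using hx)
    rw [← hx']
    simp only [g, dif_pos hxS]
    exact hxS.choose_spec.2

/-- An ultrafilter that is not `c`-complete misses every member of some cover by fewer than `c`
sets. -/
theorem Ultrafilter.exists_cover_of_not_cardinalInterFilter {α : Type u} {c : Cardinal.{u}}
    (hc : ℵ₀ ≤ c) {U : Ultrafilter α} (h : ¬ CardinalInterFilter (U : Filter α) c) :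
    ∃ S : Set (Set α), #S < c ∧ ⋃₀ S = Set.univ ∧ ∀ s ∈ S, s ∉ U := by
  obtain ⟨T, hT, hTU, hT'⟩ : ∃ T : Set (Set α), #T < c ∧ (∀ s ∈ T, s ∈ U) ∧ ⋂₀ T ∉ U := by
    by_contra! h'
    exact h ⟨h'⟩
  refine ⟨insert (⋂₀ T) (compl '' T), ?_, ?_, ?_⟩
  · exact mk_insert_le.trans_lt
      (add_lt_of_lt hc (mk_image_le.trans_lt hT) (one_lt_aleph0.trans_le hc))
  · rw [sUnion_insert, ← compl_sInter, union_compl_self]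
  · rintro s (rfl | ⟨t, ht, rfl⟩)
    · exact hT'
    · exact Ultrafilter.compl_notMem_iff.2 (hTU t ht)

end Measurable


/-! ### Closed well-orders and adjoining their ends -/

section WellOrder

variable {Z X : Type u} [LinearOrder Z] [WellFoundedLT Z] [TopologicalSpace Z] [OrderTopology Z]
  [Nonempty Z] [TopologicalSpace X] [T35Space X]

/-- A space with a closed copy of an unbounded well-order of uncountable cofinality `c` differs
from its `υ_c`. -/
theorem Topology.IsClosedEmbedding.not_upsilon_cof_subset_range [NoMaxOrder Z] {e : Z → X}
    (he : IsClosedEmbedding e) (hZ : ℵ₀ < Order.cof Z) :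
    ¬ upsilon (Order.cof Z) X ⊆ range (stoneCechUnit : X → StoneCech X) := fun h => by
  obtain ⟨p, hp⟩ :=
    exists_tendsto_atTop_of_aleph0_lt_cof hZ (continuous_stoneCechUnit.comp he.continuous)
  obtain ⟨x, rfl⟩ := h (mem_sInter.2 fun Y hY =>
    IsKLindelof.mem_of_tendsto_atTop le_rfl hY.2 ((range_comp_subset_range _ _).trans hY.1) hp)
  have hx : Tendsto e atTop (𝓝 x) := isEmbedding_stoneCechUnit.tendsto_nhds_iff.2 hp
  obtain ⟨z, rfl⟩ := he.isClosed_range.mem_of_tendsto hx (Eventually.of_forall mem_range_self)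
  have hz : Tendsto id atTop (𝓝 z) := he.isEmbedding.tendsto_nhds_iff.2 hx
  exact atTop_neBot.ne ((disjoint_nhds_atTop z).symm.eq_bot_of_le (tendsto_id'.1 hz))

/-- The sum of a space with fewer than `c` points and a well-order of uncountable cofinality at
least `c` is functorially `c`-Lindelöfifiable: the Lindelöfification adds the end of the
well-order. -/
theorem functoriallyKLindelofifiable_sum {D : Type u} [TopologicalSpace D] [T35Space D]
    [T35Space Z] {c : Cardinal.{u}} (hc : ℵ₀ < c) (hD : #D < c) (hZ : c ≤ Order.cof Z) :
    FunctoriallyKLindelofifiable c (D ⊕ Z) := by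
  let j : D ⊕ Z → StoneCech (D ⊕ Z) := stoneCechUnit
  have hj : Continuous j := continuous_stoneCechUnit
  obtain ⟨p, hp⟩ :=
    exists_tendsto_atTop_of_aleph0_lt_cof (hc.trans_le hZ) (hj.comp continuous_inr)
  let N : Set (StoneCech (D ⊕ Z)) := insert p (range j)
  have hN : IsKLindelof c N := by
    -- One compact piece is `Z` with its end; the others are the single points of `D`.
    let C : Option D → Set (StoneCech (D ⊕ Z)) := fun d =>
      d.elim (insert p (range (j ∘ Sum.inr))) fun d => {j (Sum.inl d)}
    have hC : N = ⋃ d, C d := by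
      ext q
      simp only [N, C, mem_insert_iff, mem_range, Sum.exists, iUnion_option, mem_union, mem_iUnion,
        Option.elim_none, Option.elim_some, mem_singleton_iff, Function.comp_apply, eq_comm]
      tauto
    rw [hC]
    refine isKLindelof_iUnion_of_isCompact hc ?_ ?_
    · rw [mk_option]
      exact add_lt_of_lt hc.le hD (one_lt_aleph0.trans hc)
    · rintro (_ | d)
      · exact isCompact_insert_range_of_tendsto_atTop (hj.comp continuous_inr) hp
      · exact isCompact_singleton
  let i : C(D ⊕ Z, N) := ⟨fun x => ⟨j x, Or.inr ⟨x, rfl⟩⟩, hj.subtype_mk _⟩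
  let pN : N := ⟨p, Or.inl rfl⟩
  have hi : Tendsto (i ∘ Sum.inr) atTop (𝓝 pN) := tendsto_subtype_rng.2 hp
  refine ⟨N, inferInstance, inferInstance, hN, i, fun Y _ _ hY f => ?_⟩
  have hf : Continuous (stoneCechUnit ∘ f) := continuous_stoneCechUnit.comp f.continuous
  let F := stoneCechExtend hf
  have hF : Continuous F := continuous_stoneCechExtend hf
  have hFj : ∀ x, F (j x) = stoneCechUnit (f x) := stoneCechExtend_stoneCechUnit hf
  have hFN : ∀ n : N, F n ∈ range (stoneCechUnit : Y → StoneCech Y) := by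
    rintro ⟨n, rfl | ⟨x, rfl⟩⟩
    · refine IsKLindelof.mem_of_tendsto_atTop (f := F ∘ j ∘ Sum.inr) hZ
        (hY.of_surjective (continuous_stoneCechUnit.subtype_mk fun y => ⟨y, rfl⟩)
          rangeFactorization_surjective) ?_ ((hF.tendsto _).comp hp)
      rintro _ ⟨z, rfl⟩
      exact ⟨_, (hFj _).symm⟩
    · exact ⟨_, (hFj _).symm⟩
  choose g hg using hFN
  have hgc : Continuous g := isEmbedding_stoneCechUnit.continuous_iff.2 <| by
    rw [show stoneCechUnit ∘ g = fun n : N => F n from funext hg]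
    exact hF.comp continuous_subtype_val
  have hgi : ∀ x, g (i x) = f x := fun x =>
    injective_stoneCechUnit_of_t35Space ((hg _).trans (hFj x))
  refine ⟨⟨g, hgc⟩, ContinuousMap.ext hgi, fun h hh => ContinuousMap.ext fun n => ?_⟩
  have hhi : ∀ x, h (i x) = g (i x) := fun x => (DFunLike.congr_fun hh x).trans (hgi x).symm
  obtain ⟨n, rfl | ⟨x, rfl⟩⟩ := n
  -- The added point is a limit of points of `Z`, so its value is forced.
  · refine tendsto_nhds_unique ((h.continuous.tendsto pN).comp hi) ?_
    convert! (hgc.tendsto pN).comp hi using 1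
    exact funext fun z => hhi _
  · exact hhi x

end WellOrder

/-! ### Obstruction to a functorial Lindelöfification -/

section Ultrafilter

variable {D : Type u}

/-- If no nonprincipal ultrafilter on `D` is `c`-complete, then for every nonprincipal one there
is a `c`-Lindelöf space of ultrafilters that contains the principal ones but not the given one. -/
theorem Ultrafilter.exists_isKLindelof_notMem {c : Cardinal.{u}} (hc : ℵ₀ < c) {q : Ultrafilter D}
    (hq : ¬ CardinalInterFilter (q : Filter D) c) :
    ∃ Y : Set (Ultrafilter D), range pure ⊆ Y ∧ IsKLindelof c Y ∧ q ∉ Y := by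
  obtain ⟨S, hS, hcov, hSq⟩ := exists_cover_of_not_cardinalInterFilter hc.le hq
  refine ⟨⋃ s : S, {u | s.1 ∈ u}, ?_, isKLindelof_iUnion_of_isCompact hc hS
    fun s => (ultrafilter_isClosed_basic s.1).isCompact, ?_⟩
  · rintro _ ⟨d, rfl⟩
    obtain ⟨s, hs, hd⟩ : d ∈ ⋃₀ S := hcov ▸ mem_univ d
    exact mem_iUnion.2 ⟨⟨s, hs⟩, hd⟩
  · simpa using hSq

/-- The sum of a discrete space `D` whose cardinality `c` is uncountable and admits no nonprincipal
`c`-complete ultrafilter with any other space is not functorially `c`-Lindelöfifiable. -/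
theorem not_functoriallyKLindelofifiable_sum [TopologicalSpace D] [DiscreteTopology D] {Z : Type u}
    [TopologicalSpace Z] (hD : ℵ₀ < #D)
    (hpure : ∀ q : Ultrafilter D, CardinalInterFilter (q : Filter D) #D → ∃ d, q = pure d) :
    ¬ FunctoriallyKLindelofifiable #D (D ⊕ Z) := by
  rintro ⟨N, _, _, hN, i, hi⟩
  obtain ⟨d₀⟩ : Nonempty D := mk_ne_zero_iff.1 (aleph0_pos.trans hD).ne'
  let f : C(D ⊕ Z, Ultrafilter D) :=
    ⟨Sum.elim pure fun _ => pure d₀, continuous_of_discreteTopology.sumElim continuous_const⟩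
  have hf : ∀ x, f x ∈ range (pure : D → Ultrafilter D) := by
    rintro (d | z)
    exacts [⟨d, rfl⟩, ⟨d₀, rfl⟩]
  obtain ⟨G, hG, hGu⟩ :=
    hi (Ultrafilter D) inferInstance (isKLindelof_of_compactSpace hD _) f
  have hGi : ∀ x, G (i x) = f x := DFunLike.congr_fun hG
  -- The map also factors through any `#D`-Lindelöf `Y` containing the principal ultrafilters;
  -- uniqueness of `G` forces its values into `Y`.
  have hrange : ∀ n, ∃ d, G n = pure d := fun n => hpure _ <| by
    by_contra hq
    obtain ⟨Y, hY, hYL, hnY⟩ := Ultrafilter.exists_isKLindelof_notMem hD hq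
    obtain ⟨g, hg, -⟩ := hi Y inferInstance hYL
      ⟨fun x => ⟨f x, hY (hf x)⟩, f.continuous.subtype_mk _⟩
    have : (⟨Subtype.val, continuous_subtype_val⟩ : C(Y, Ultrafilter D)).comp g = G :=
      hGu _ (ContinuousMap.ext fun x => congrArg Subtype.val (DFunLike.congr_fun hg x))
    exact hnY (this ▸ (g n).2)
  let W : D → Set N := fun d => {n | {d} ∈ G n}
  have hW : ∀ d, IsOpen (W d) := fun d => (ultrafilter_isOpen_basic {d}).preimage G.continuous
  -- Each `i (Sum.inl d)` lies in no `W d'` but its own, so no subcover can drop a member.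
  have hiW : ∀ d d', i (Sum.inl d) ∈ W d' → d = d' := fun d d' h => by
    have h' : {d'} ∈ G (i (Sum.inl d)) := h
    rw [hGi] at h'
    exact h'
  obtain ⟨V, hVW, hV, hcard⟩ := hN (range W) (by rintro _ ⟨d, rfl⟩; exact hW d)
    (eq_univ_of_forall fun n => by
      obtain ⟨d, hd⟩ := hrange n
      refine ⟨_, ⟨d, rfl⟩, ?_⟩
      change {d} ∈ G n
      rw [hd]
      exact Ultrafilter.mem_pure.2 rfl)
  have hWV : ∀ d, ∃ v ∈ V, i (Sum.inl d) ∈ v := fun d => by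
    have : i (Sum.inl d) ∈ ⋃₀ V := hV ▸ mem_univ _
    exact this
  choose v hvV hv using hWV
  refine hcard.not_ge (mk_le_of_injective (f := fun d => (⟨v d, hvV d⟩ : V)) fun d d' h => ?_)
  obtain ⟨a, ha⟩ := hVW (hvV d)
  have h : v d = v d' := congrArg Subtype.val h
  have h1 := hv d
  have h2 := hv d'
  rw [← ha] at h1
  rw [← h, ← ha] at h2
  exact (hiW _ _ h1).trans (hiW _ _ h2).symm

end Ultrafilter

/-! ### Sums with a large discrete summand -/

section DiscreteSum

variable {A B : Type u} [TopologicalSpace A] [TopologicalSpace B] [DiscreteTopology B]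

/-- If every countably complete ultrafilter on the discrete space `B` is principal, then `A ⊕ B`
equals its `υ_c` for every uncountable `c` above the cardinality of `A`. -/
theorem upsilon_sum_subset_range {c : Cardinal.{u}} (hc : ℵ₀ < c) (hA : #A < c)
    (hB : ∀ q : Ultrafilter B, CountableInterFilter (q : Filter B) → ∃ b, q = pure b) :
    upsilon c (A ⊕ B) ⊆ range (stoneCechUnit : A ⊕ B → StoneCech (A ⊕ B)) := by
  intro p hp
  by_contra hpr
  let j : A ⊕ B → StoneCech (A ⊕ B) := stoneCechUnit
  obtain ⟨S, hS, hcov, hSp⟩ : ∃ S : Set (Set B), #S ≤ ℵ₀ ∧ ⋃₀ S = Set.univ ∧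
      ∀ s ∈ S, p ∉ closure (j '' (Sum.inr '' s)) := by
    by_cases hpB : p ∈ closure (j '' range Sum.inr)
    · rw [← range_comp] at hpB
      have hne : (comap (j ∘ Sum.inr) (𝓝 p)).NeBot := 
        comap_neBot_iff_frequently.2 (mem_closure_iff_frequently.1 hpB)
      let q : Ultrafilter B := Ultrafilter.of (comap (j ∘ Sum.inr) (𝓝 p))
      have hq : Tendsto (j ∘ Sum.inr) (q : Filter B) (𝓝 p) :=
        tendsto_iff_comap.2 (Ultrafilter.of_le _)
      have hqn : ¬ CardinalInterFilter (q : Filter B) ℵ₁ := fun h => by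
        obtain ⟨b, hb⟩ := hB q (CardinalInterFilter.toCountableInterFilter _ aleph0_lt_aleph_one)
        rw [hb] at hq
        exact hpr ⟨_, tendsto_nhds_unique (tendsto_pure_nhds _ b) hq⟩
      obtain ⟨S, hS, hcov, hSq⟩ :=
        Ultrafilter.exists_cover_of_not_cardinalInterFilter aleph0_lt_aleph_one.le hqn
      refine ⟨S, lt_aleph_one_iff.1 hS, hcov, fun s hs hps => hSq s hs ?_⟩
      have hclopen : IsClopen (Sum.inr '' s : Set (A ⊕ B)) :=
        ⟨IsClosedEmbedding.inr.isClosedMap _ (isClosed_discrete s),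
          isOpenMap_inr _ (isOpen_discrete s)⟩
      have := hclopen.mem_of_tendsto_stoneCechUnit hps (u := q.map Sum.inr) (tendsto_map'_iff.2 hq)
      rwa [Ultrafilter.mem_map, preimage_image_eq _ Sum.inr_injective] at this
    · refine ⟨{Set.univ}, by simp, sUnion_singleton _, ?_⟩
      rintro _ rfl
      rwa [image_univ]
  let C : A ⊕ S → Set (StoneCech (A ⊕ B)) :=
    Sum.elim (fun a => {j (Sum.inl a)}) fun s => closure (j '' (Sum.inr '' s.1))
  have hpC : p ∈ ⋃ x, C x := by
    refine mem_sInter.1 hp _ ⟨?_, isKLindelof_iUnion_of_isCompact hc ?_ ?_⟩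
    · rintro _ ⟨a | b, rfl⟩
      · exact mem_iUnion.2 ⟨Sum.inl a, rfl⟩
      · obtain ⟨s, hs, hb⟩ : b ∈ ⋃₀ S := hcov ▸ mem_univ b
        exact mem_iUnion.2 ⟨Sum.inr ⟨s, hs⟩,
          subset_closure (mem_image_of_mem _ (mem_image_of_mem _ hb))⟩
    · simpa using add_lt_of_lt hc.le hA (hS.trans_lt hc)
    · rintro (a | s)
      exacts [isCompact_singleton, isClosed_closure.isCompact]
  obtain ⟨a | s, hx⟩ := mem_iUnion.1 hpC
  · exact hpr ⟨_, (mem_singleton_iff.1 hx).symm⟩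
  · exact hSp s s.2 hx

/-- In the cover by `A` and the singletons of `B`, no singleton can be omitted. -/
theorem mk_le_lindelofDegree_sum : #B ≤ lindelofDegree (A ⊕ B) := by
  obtain ⟨V, hVU, hV, hcard⟩ := (csInf_mem (lindelofDegree_set_nonempty (A ⊕ B))).2
    (insert (range Sum.inl) (range fun b => {Sum.inr b}))
    (by
      rintro _ (rfl | ⟨b, rfl⟩)
      · exact isOpen_range_inl
      · simpa using isOpenMap_inr (X := A) _ (isOpen_discrete {b}))
    (eq_univ_of_forall <| by
      rintro (a | b)
      exacts [⟨_, Or.inl rfl, ⟨a, rfl⟩⟩, ⟨_, Or.inr ⟨b, rfl⟩, rfl⟩])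
  have hb : ∀ b, {Sum.inr b} ∈ V := fun b => by
    obtain ⟨v, hv, hbv⟩ : Sum.inr b ∈ ⋃₀ V := hV ▸ mem_univ _
    obtain rfl | ⟨b', rfl⟩ := hVU hv
    · simp at hbv
    · rwa [mem_singleton_iff.1 hbv]
  exact (mk_le_of_injective (f := fun b => (⟨_, hb b⟩ : V)) fun b b' h => by
    simpa using h).trans hcard

end DiscreteSum

/-! ### Specialization to cardinals and the theorem -/

section Ordinals

instance (α : Ordinal.{u}) : WellFoundedLT (OrdSpace α) :=
  inferInstanceAs (WellFoundedLT α.ToType)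

theorem mk_ordSpace_ord (c : Cardinal.{u}) : #(OrdSpace c.ord) = c := mk_ord_toType c

theorem mk_ordDiscrete_ord (c : Cardinal.{u}) : #(OrdDiscrete c.ord) = c := mk_ord_toType c

theorem cof_ordSpace (α : Ordinal.{u}) : Order.cof (OrdSpace α) = α.cof := Ordinal.cof_toType α

theorem noMaxOrder_ordSpace_ord {c : Cardinal.{u}} (hc : ℵ₀ ≤ c) : NoMaxOrder (OrdSpace c.ord) :=
  Cardinal.noMaxOrder hc

theorem nonempty_ordSpace_ord {c : Cardinal.{u}} (hc : ℵ₀ ≤ c) : Nonempty (OrdSpace c.ord) :=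
  mk_ne_zero_iff.1 (by rw [mk_ordSpace_ord]; exact (aleph0_pos.trans_le hc).ne')

/-- A space with a closed copy of a regular uncountable cardinal `c` has outer Lindelöf degree at
least `c`. -/
theorem Topology.IsClosedEmbedding.le_outerLindelofDegree {c : Cardinal.{u}} (hc : ℵ₀ < c)
    (hreg : c.ord.cof = c) {X : Type u} [TopologicalSpace X] [T35Space X] {e : OrdSpace c.ord → X}
    (he : IsClosedEmbedding e) : c ≤ outerLindelofDegree X := by
  have := noMaxOrder_ordSpace_ord hc.le
  have := nonempty_ordSpace_ord hc.le
  have hcof : Order.cof (OrdSpace c.ord) = c := (cof_ordSpace _).trans hreg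
  have h := he.not_upsilon_cof_subset_range (by rwa [hcof])
  rw [hcof] at h
  exact _root_.le_outerLindelofDegree h

end Ordinals

theorem mainTheorem11 (κ lam : Cardinal.{u}) (hκ : ℵ₀ ≤ κ) (hlam : ℵ₀ ≤ lam)
    (hκm : ¬ IsMeasurableCardinal κ) (hlamm : ¬ IsMeasurableCardinal lam) :
    ((∀ ν : Cardinal.{u}, ν ≤ lam → ¬ IsMeasurableCardinal ν) →
      ℵ₀ < κ.ord.cof → κ.ord.cof = κ → κ < lam →
        outerLindelofDegree (OrdSpace κ.ord ⊕ OrdDiscrete lam.ord) = κ ∧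
        κ < lindelofDegree (OrdSpace κ.ord ⊕ OrdDiscrete lam.ord) ∧
        lindelofDegree (OrdSpace κ.ord ⊕ OrdDiscrete lam.ord) = lam) ∧
    (κ < lam.ord.cof → lam.ord.cof = lam →
        outerLindelofDegree (OrdDiscrete κ.ord ⊕ OrdSpace lam.ord) = lam ∧
        lindelofDegree (OrdDiscrete κ.ord ⊕ OrdSpace lam.ord) = lam ∧
        (∀ μ : Cardinal.{u}, κ < μ → μ ≤ lam →
          FunctoriallyKLindelofifiable μ (OrdDiscrete κ.ord ⊕ OrdSpace lam.ord)) ∧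
        (ℵ₀ < κ →
          ¬ FunctoriallyKLindelofifiable κ (OrdDiscrete κ.ord ⊕ OrdSpace lam.ord))) := by
  constructor
  · intro hm hunc hreg hlt
    rw [hreg] at hunc
    have hL : lindelofDegree (OrdSpace κ.ord ⊕ OrdDiscrete lam.ord) = lam := by
      refine (lindelofDegree_le hlam ?_).antisymm
        ((mk_ordDiscrete_ord lam).ge.trans mk_le_lindelofDegree_sum)
      rw [mk_sum, lift_id, lift_id, mk_ordSpace_ord, mk_ordDiscrete_ord]
      exact (add_eq_right hlam hlt.le).le
    refine ⟨(outerLindelofDegree_le hκ (upsilon_sum_subset_range ?_ ?_ fun q _ =>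
      exists_eq_pure_of_countableInterFilter ?_ q)).antisymm
        (IsClosedEmbedding.inl.le_outerLindelofDegree hunc hreg), hL.symm ▸ hlt, hL⟩
    · exact hκ.trans_lt (Order.lt_succ κ)
    · rw [mk_ordSpace_ord]
      exact Order.lt_succ κ
    · rwa [mk_ordDiscrete_ord]
  · intro hlt hreg
    rw [hreg] at hlt
    have hoL : lam ≤ outerLindelofDegree (OrdDiscrete κ.ord ⊕ OrdSpace lam.ord) :=
      IsClosedEmbedding.inr.le_outerLindelofDegree (hκ.trans_lt hlt) hreg
    have hL : lindelofDegree (OrdDiscrete κ.ord ⊕ OrdSpace lam.ord) ≤ lam := by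
      refine lindelofDegree_le hlam ?_
      rw [mk_sum, lift_id, lift_id, mk_ordSpace_ord, mk_ordDiscrete_ord]
      exact (add_eq_right hlam hlt.le).le
    have hoLL := outerLindelofDegree_le_lindelofDegree (OrdDiscrete κ.ord ⊕ OrdSpace lam.ord)
    refine ⟨(hoLL.trans hL).antisymm hoL, hL.antisymm (hoL.trans hoLL), fun μ hκμ hμ => ?_,
      fun hunc => ?_⟩
    · have := nonempty_ordSpace_ord hlam
      exact functoriallyKLindelofifiable_sum (hκ.trans_lt hκμ) (by rwa [mk_ordDiscrete_ord])
        (by rwa [cof_ordSpace, hreg])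
    · have h := not_functoriallyKLindelofifiable_sum (D := OrdDiscrete κ.ord)
        (Z := OrdSpace lam.ord) (by rwa [mk_ordDiscrete_ord]) fun q hq => by
          by_contra! hne
          rw [mk_ordDiscrete_ord] at hq
          exact hκm ⟨hunc, q, hq, hne⟩
      rwa [mk_ordDiscrete_ord] at h
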